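/- Let $M$ be a smooth $n$-dimensional manifold (Hausdorff, second countable, without boundary). An implicit system on $M$ is a smooth map $F\colon TM\to\mathbb R^n$; its system surface is $S_F=F^{-1}(0)\subset TM$, and its folding is the restriction $\pi|_{S_F}\colon S_F\to M$ of the bundle projection $\pi\colon TM\to M$. The system has locally bounded derivatives if its folding is a proper map. The space of such systems carries the topology induced by the fine (strong) Whitney $C^\infty$ topology on $C^\infty(TM,\mathbb R^n)$, and a property holds for a generic system if it holds for all systems in some open everywhere dense subset of this space. A point $p\in S_F$ is a critical point of the folding if $d\pi_p|_{\ker dF_p}\colon\ker dF_p\to T_{\pi(p)}M$ is not an isomorphism (in particular, every point of $S_F$ at which $dF_p$ is not surjective counts as critical). The 1-folding is the partial map from $S_F$ to the projectivized tangent bundle $PTM$ that sends $(x,v)\in S_F$ with $v\neq0$ to $(x,[v])$. Then, for a generic implicit system $F$ with locally bounded derivatives, no critical point of the folding of $F$ lies on the zero section of $TM$; in particular, every critical point of the folding has a neighbourhood in $S_F$ on which the 1-folding is well defined. -/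

import Mathlib

open scoped Manifold ContDiff Topology LinearAlgebra.Projectivization

noncomputable section

namespace ImplicitSystem

section Whitney

variable {E H X V : Type*} [NormedAddCommGroup E] [NormedSpace ℝ E] [TopologicalSpace H]
  (I : ModelWithCorners ℝ E H) [I.Boundaryless] [TopologicalSpace X] [ChartedSpace H X]
  [NormedAddCommGroup V] [NormedSpace ℝ V]

/-- The set of the smooth maps `g : X → V` whose derivatives of order at most `r`, read in the
chart `φ i`, are `ε i`-close to those of `f` on `K i`, for every `i`. -/
def strongNhd (f : C^∞⟮I, X; 𝓘(ℝ, V), V⟯) (r : ℕ) {ι : Type}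
    (φ : ι → OpenPartialHomeomorph X H) (K : ι → Set X) (ε : ι → ℝ) :
    Set C^∞⟮I, X; 𝓘(ℝ, V), V⟯ :=
  {g | ∀ i, ∀ x ∈ K i, ∀ k ≤ r,
    ‖iteratedFDeriv ℝ k (g ∘ ((φ i).extend I).symm) ((φ i).extend I x) -
      iteratedFDeriv ℝ k (f ∘ ((φ i).extend I).symm) ((φ i).extend I x)‖ < ε i}

/-- The fine (strong) Whitney `C^∞` topology on the smooth maps from a manifold `X` without
boundary to a normed space `V`: its basic open sets are the sets `strongNhd f r φ K ε`, where `r`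
is any finite order, `φ` is a locally finite family of smooth charts of `X`, the set `K i` is a
compact subset of the domain of `φ i`, and `ε i > 0`. -/
@[reducible]
def whitneyTopology : TopologicalSpace C^∞⟮I, X; 𝓘(ℝ, V), V⟯ :=
  TopologicalSpace.generateFrom
    {N | ∃ (f : C^∞⟮I, X; 𝓘(ℝ, V), V⟯) (r : ℕ) (ι : Type)
        (φ : ι → OpenPartialHomeomorph X H) (K : ι → Set X) (ε : ι → ℝ),
      (∀ i, φ i ∈ IsManifold.maximalAtlas I ∞ X) ∧
      LocallyFinite (fun i => (φ i).source) ∧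
      (∀ i, IsCompact (K i) ∧ K i ⊆ (φ i).source) ∧
      (∀ i, 0 < ε i) ∧
      N = strongNhd I f r φ K ε}

end Whitney

variable (n : ℕ) (M : Type*) [TopologicalSpace M] [ChartedSpace (EuclideanSpace ℝ (Fin n)) M]
  [IsManifold (𝓡 n) ∞ M]

/-- An implicit system `F(x, ẋ) = 0` on the `n`-dimensional manifold `M`: a smooth map from the
tangent bundle of `M` to the `n`-dimensional Cartesian space. -/
abbrev System : Type _ :=
  C^∞⟮(𝓡 n).tangent, TangentBundle (𝓡 n) M;
    𝓘(ℝ, EuclideanSpace ℝ (Fin n)), EuclideanSpace ℝ (Fin n)⟯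

variable {n M}

/-- The system surface: the zero level of `F`. -/
def surface (F : System n M) : Set (TangentBundle (𝓡 n) M) := {p | F p = 0}

/-- The system folding: the restriction of the bundle projection to the system surface. -/
def folding (F : System n M) (p : surface F) : M := p.1.proj

/-- A point `p` of the system surface is a critical point of the folding if the derivative of the
bundle projection, restricted to the tangent space `ker dF_p` of the surface, is not an
isomorphism onto the tangent space of `M`. (At a point where `dF_p` is not surjective the kernel
has dimension greater than `n`, so such a point always counts as critical.) -/
def IsCriticalPoint (F : System n M) (p : surface F) : Prop :=
  ¬ Function.Bijective
    (fun w : LinearMap.ker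
        (mfderiv (𝓡 n).tangent 𝓘(ℝ, EuclideanSpace ℝ (Fin n)) F p.1).toLinearMap =>
      mfderiv (𝓡 n).tangent (𝓡 n)
        (Bundle.TotalSpace.proj : TangentBundle (𝓡 n) M → M) p.1 w.1)

/-- The system 1-folding: the restriction to the system surface of the projectivization
`(x, v) ↦ (x, [v])` of the tangent bundle. It is a partial map, defined where the velocity is
nonzero. -/
def oneFolding (F : System n M) :
    surface F →. (Σ x : M, ℙ ℝ (TangentSpace (𝓡 n) x)) :=
  fun p => ⟨p.1.snd ≠ 0, fun h => ⟨p.1.proj, Projectivization.mk ℝ p.1.snd h⟩⟩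

variable (n M)

/-- The implicit systems with locally bounded derivatives: those whose folding is proper. -/
def LBDSystem : Type _ := {F : System n M // IsProperMap (folding F)}

/-- The space of systems with locally bounded derivatives carries the topology induced by the
fine Whitney topology. -/
instance : TopologicalSpace (LBDSystem n M) :=
  (whitneyTopology (𝓡 n).tangent).induced Subtype.val

variable {n M}

/-- A property holds for a generic system with locally bounded derivatives if it holds on some
open everywhere dense subset of the space of such systems. -/
def Generic (P : System n M → Prop) : Prop :=
  ∃ G : Set (LBDSystem n M), IsOpen G ∧ Dense G ∧ ∀ F ∈ G, P F.1

end ImplicitSystem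

end

/-! If the derivative of `F` along the fibre is invertible at a zero vector, then `ker dF` is a
graph over the base directions and projects isomorphically. So a critical point `(x, 0)` forces both
`F (x, 0) = 0` and `det ∂ᵥF (x, 0) = 0`: `n + 1` scalar conditions on the `n` coordinates of `x`,
which generically have no solution. `IsRegularZero` says that they fail at `x`, and
`IsRegularZero.not_isCriticalPoint` draws the conclusion.

Openness: over a compact set regularity survives `C¹`-small changes, and a locally finite family of
such sets covers `M` (`isOpen_setOf_isRegularZero`).

Density: near the zero section, where the bump function is `1`, the deformation `b + t v` shifts the
value by `b` and the fibre derivative by `t • id`. Fubini and the nullity of differentiable images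
of null sets show that almost every `t`, then almost every `b`, works over one compact set
(`exists_shift_det_ne_zero`). All sets are treated together by Baire's theorem, applied not to the
Whitney space but to a compact product of parameter balls (`exists_sum_isRegularZero`), with radii
small enough to stay in a given Whitney neighbourhood (`exists_forall_add_sum_mem`). The
deformations have compact carriers, locally finite over `M`, so the folding stays proper
(`isProperMap_folding_add`). -/

noncomputable section

namespace ImplicitSystem

/-! ### Derivatives in charts and locally finite sums of deformations. -/

section ChartDerivatives

variable {E H X V : Type*} [NormedAddCommGroup E] [NormedSpace ℝ E] [TopologicalSpace H]
  {I : ModelWithCorners ℝ E H} [TopologicalSpace X]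
  [NormedAddCommGroup V] [NormedSpace ℝ V]

/-- The `k`-th derivative of `g` at the point `x`, read in the chart `φ`. -/
def chartDeriv (I : ModelWithCorners ℝ E H) (φ : OpenPartialHomeomorph X H) (k : ℕ) (g : X → V)
    (x : X) : ContinuousMultilinearMap ℝ (fun _ : Fin k => E) V :=
  iteratedFDeriv ℝ k (g ∘ (φ.extend I).symm) (φ.extend I x)

lemma chartDeriv_congr {φ : OpenPartialHomeomorph X H} {g g' : X → V} {x : X} (hx : x ∈ φ.source)
    (h : g =ᶠ[𝓝 x] g') (k : ℕ) : chartDeriv I φ k g x = chartDeriv I φ k g' x := by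
  have hc := φ.continuousAt_extend_symm (I := I) hx
  rw [ContinuousAt, φ.extend_left_inv hx] at hc
  have h' : g ∘ (φ.extend I).symm =ᶠ[𝓝 (φ.extend I x)] g' ∘ (φ.extend I).symm := hc.eventually h
  exact (h'.iteratedFDeriv ℝ k).eq_of_nhds

variable [ChartedSpace H X]

lemma contDiffOn_comp_extend_symm {φ : OpenPartialHomeomorph X H}
    (hφ : φ ∈ IsManifold.maximalAtlas I ∞ X) {g : X → V} (hg : ContMDiff I 𝓘(ℝ, V) ∞ g) :
    ContDiffOn ℝ ∞ (g ∘ (φ.extend I).symm) (φ.extend I).target := by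
  rw [← contMDiffOn_iff_contDiffOn]
  have h := contMDiffOn_extend_symm hφ
  rw [← φ.extend_target'] at h
  exact hg.comp_contMDiffOn h

variable (I X V) in
/-- A locally finite family of linear deformations with compact supports. -/
structure DeformationFamily (ι W : Type*) [NormedAddCommGroup W] [NormedSpace ℝ W] where
  /-- The deformation with the index `i` and the parameter `w`. -/
  toFun : ι → W →ₗ[ℝ] C^∞⟮I, X; 𝓘(ℝ, V), V⟯
  /-- A set outside which the deformations with the index `i` vanish. -/
  carrier : ι → Set X
  isClosed_carrier : ∀ i, IsClosed (carrier i)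
  isCompact_carrier : ∀ i, IsCompact (carrier i)
  locallyFinite : LocallyFinite carrier
  eq_zero : ∀ i w x, x ∉ carrier i → toFun i w x = 0

namespace DeformationFamily

variable {ι W : Type*} [NormedAddCommGroup W] [NormedSpace ℝ W]
  (u : DeformationFamily X V I ι W)

lemma support_subset (i : ι) (w : W) : Function.support (u.toFun i w) ⊆ u.carrier i := by
  intro x hx
  by_contra h
  exact hx (u.eq_zero i w x h)

/-- The sum of the deformations with the parameters `s i`. -/
def sum (s : ι → W) : C^∞⟮I, X; 𝓘(ℝ, V), V⟯ :=
  ⟨fun x => ∑ᶠ i, u.toFun i (s i) x, contMDiff_finsum (fun i => (u.toFun i (s i)).contMDiff)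
    (u.locallyFinite.subset fun i => u.support_subset i (s i))⟩

lemma sum_apply (s : ι → W) (x : X) : u.sum s x = ∑ᶠ i, u.toFun i (s i) x := rfl

lemma finite_apply (s : ι → W) (x : X) :
    (Function.support fun i => u.toFun i (s i) x).Finite :=
  (u.locallyFinite.point_finite x).subset fun i hi => u.support_subset i (s i) hi

lemma sum_sub (s s' : ι → W) : u.sum (s - s') = u.sum s - u.sum s' := by
  ext x
  rw [ContMDiffMap.coe_sub, Pi.sub_apply, sum_apply, sum_apply, sum_apply,
    ← finsum_sub_distrib (u.finite_apply s x) (u.finite_apply s' x)]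
  simp

/-- Isolates one parameter, so that it can be chosen with all the others frozen. -/
lemma sum_update [DecidableEq ι] (s : ι → W) (i : ι) (w : W) :
    u.sum (Function.update s i w) = u.sum (Function.update s i 0) + u.toFun i w := by
  have h := u.sum_sub (Function.update s i w) (Function.update s i 0)
  rw [← sub_eq_iff_eq_add', ← h]
  ext x
  rw [sum_apply, finsum_eq_single _ i]
  · simp
  · intro j hj
    simp [hj]

lemma sum_eventuallyEq (s : ι → W) (x : X) :
    ∃ J : Finset ι, u.sum s =ᶠ[𝓝 x] (∑ i ∈ J, u.toFun i (s i) : C^∞⟮I, X; 𝓘(ℝ, V), V⟯) := by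
  obtain ⟨t, ht, hf⟩ := u.locallyFinite x
  refine ⟨hf.toFinset, Filter.eventually_of_mem ht fun y hy => ?_⟩
  rw [sum_apply, finsum_eq_sum_of_support_subset (s := hf.toFinset)]
  · rw [← ContMDiffMap.coeFnAddMonoidHom_apply, map_sum, Finset.sum_apply]
    rfl
  · intro i hi
    simp only [Set.Finite.coe_toFinset, Set.mem_ofPred_eq]
    exact ⟨y, u.support_subset i (s i) hi, hy⟩

end DeformationFamily

variable [I.Boundaryless]

lemma contDiffAt_comp_extend_symm {φ : OpenPartialHomeomorph X H}
    (hφ : φ ∈ IsManifold.maximalAtlas I ∞ X) {g : X → V} (hg : ContMDiff I 𝓘(ℝ, V) ∞ g)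
    {x : X} (hx : x ∈ φ.source) :
    ContDiffAt ℝ ∞ (g ∘ (φ.extend I).symm) (φ.extend I x) :=
  (contDiffOn_comp_extend_symm hφ hg).contDiffAt <|
    φ.isOpen_extend_target.mem_nhds ((φ.extend I).map_source (by rwa [φ.extend_source]))

lemma continuousOn_chartDeriv {φ : OpenPartialHomeomorph X H}
    (hφ : φ ∈ IsManifold.maximalAtlas I ∞ X) {g : X → V} (hg : ContMDiff I 𝓘(ℝ, V) ∞ g) (k : ℕ) :
    ContinuousOn (chartDeriv I φ k g) φ.source := by
  intro x hx
  have h := (contDiffAt_comp_extend_symm hφ hg hx).continuousAt_iteratedFDeriv (k := k)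
    (by exact_mod_cast le_top)
  exact (ContinuousAt.comp (f := φ.extend I) h (φ.continuousAt_extend hx)).continuousWithinAt

/-- The `k`-th derivative at a point `x` of the domain of a chart, as a linear map on the space of
smooth maps. -/
def chartDerivLinear {φ : OpenPartialHomeomorph X H} (hφ : φ ∈ IsManifold.maximalAtlas I ∞ X)
    (k : ℕ) {x : X} (hx : x ∈ φ.source) :
    C^∞⟮I, X; 𝓘(ℝ, V), V⟯ →ₗ[ℝ] ContinuousMultilinearMap ℝ (fun _ : Fin k => E) V where
  toFun g := chartDeriv I φ k g x
  map_add' f g := iteratedFDeriv_add_apply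
    ((contDiffAt_comp_extend_symm hφ f.contMDiff hx).of_le (by exact_mod_cast le_top))
    ((contDiffAt_comp_extend_symm hφ g.contMDiff hx).of_le (by exact_mod_cast le_top))
  map_smul' a g := iteratedFDeriv_const_smul_apply
    ((contDiffAt_comp_extend_symm hφ g.contMDiff hx).of_le (by exact_mod_cast le_top))

lemma chartDerivLinear_apply {φ : OpenPartialHomeomorph X H}
    (hφ : φ ∈ IsManifold.maximalAtlas I ∞ X) (k : ℕ) {x : X} (hx : x ∈ φ.source)
    (g : C^∞⟮I, X; 𝓘(ℝ, V), V⟯) : chartDerivLinear hφ k hx g = chartDeriv I φ k g x := rfl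

/-- On a compact subset of the domain of a chart, the derivatives of order at most `r` of a smooth
map depending linearly on a finite-dimensional parameter are bounded by the parameter. -/
lemma exists_chartDeriv_le {W : Type*} [NormedAddCommGroup W] [NormedSpace ℝ W]
    [FiniteDimensional ℝ W] (u : W →ₗ[ℝ] C^∞⟮I, X; 𝓘(ℝ, V), V⟯) {φ : OpenPartialHomeomorph X H}
    (hφ : φ ∈ IsManifold.maximalAtlas I ∞ X) {K : Set X} (hK : IsCompact K) (hKφ : K ⊆ φ.source)
    (r : ℕ) :
    ∃ C, 0 < C ∧ ∀ w, ∀ x ∈ K, ∀ k ≤ r, ‖chartDeriv I φ k (u w) x‖ ≤ C * ‖w‖ := by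
  have hbd : ∀ (g : C^∞⟮I, X; 𝓘(ℝ, V), V⟯) (k : ℕ), ∃ C, ∀ x ∈ K, ‖chartDeriv I φ k g x‖ ≤ C :=
    fun g k => hK.exists_bound_of_continuousOn
      ((continuousOn_chartDeriv hφ g.contMDiff k).mono hKφ)
  choose B hB using hbd
  let b := Module.finBasis ℝ W
  let c : Fin (Module.finrank ℝ W) → W →L[ℝ] ℝ := fun j => (b.coord j).toContinuousLinearMap
  -- The summand `1` only makes the constant positive, so that it can later serve as a divisor.
  refine ⟨1 + ∑ k ∈ Finset.range (r + 1), ∑ j, ‖c j‖ * |B (u (b j)) k|, by positivity, ?_⟩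
  intro w x hx k hk
  have hexp : chartDeriv I φ k (u w) x = ∑ j, c j w • chartDeriv I φ k (u (b j)) x := by
    have : u w = ∑ j, c j w • u (b j) := by
      conv_lhs => rw [← b.sum_repr w, map_sum]
      simp only [map_smul]
      rfl
    simp only [← chartDerivLinear_apply hφ k (hKφ hx)]
    rw [this, map_sum]
    simp
  calc ‖chartDeriv I φ k (u w) x‖ ≤ ∑ j, ‖c j‖ * |B (u (b j)) k| * ‖w‖ := by
        rw [hexp]
        refine norm_sum_le_of_le _ fun j _ => ?_
        rw [norm_smul]
        calc _ ≤ (‖c j‖ * ‖w‖) * |B (u (b j)) k| := by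
              gcongr
              · exact (c j).le_opNorm w
              · exact (hB _ k x hx).trans (le_abs_self _)
          _ = _ := by ring
    _ = (∑ j, ‖c j‖ * |B (u (b j)) k|) * ‖w‖ := by rw [Finset.sum_mul]
    _ ≤ _ := by
        gcongr
        have := Finset.single_le_sum (f := fun k => ∑ j, ‖c j‖ * |B (u (b j)) k|)
          (fun k _ => by positivity) (Finset.mem_range.2 (Nat.lt_succ_of_le hk))
        linarith

namespace DeformationFamily

variable {ι W : Type*} [NormedAddCommGroup W] [NormedSpace ℝ W]
  (u : DeformationFamily X V I ι W)

/-- Only the deformations with carriers containing the point contribute to the derivatives of the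
sum. -/
lemma norm_chartDeriv_sum_le {φ : OpenPartialHomeomorph X H}
    (hφ : φ ∈ IsManifold.maximalAtlas I ∞ X) {x : X} (hx : x ∈ φ.source) {J : Finset ι}
    (hJ : ∀ i, x ∈ u.carrier i → i ∈ J) (s : ι → W) (k : ℕ) :
    ‖chartDeriv I φ k (u.sum s) x‖ ≤ ∑ i ∈ J, ‖chartDeriv I φ k (u.toFun i (s i)) x‖ := by
  classical
  obtain ⟨J', hJ'⟩ := u.sum_eventuallyEq s x
  rw [chartDeriv_congr hx hJ', ← chartDerivLinear_apply hφ k hx, map_sum]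
  -- The carrier is closed, so a deformation whose carrier misses `x` vanishes near `x`, along with
  -- its derivatives.
  have hz : ∀ i ∉ J, chartDerivLinear hφ k hx (u.toFun i (s i)) = 0 := by
    intro i hi
    have hxi : x ∉ u.carrier i := fun h => hi (hJ i h)
    rw [chartDerivLinear_apply, chartDeriv_congr (g' := (0 : C^∞⟮I, X; 𝓘(ℝ, V), V⟯)) hx ?_,
      ← chartDerivLinear_apply hφ k hx, map_zero]
    filter_upwards [(u.isClosed_carrier i).isOpen_compl.mem_nhds hxi] with y hy
    exact u.eq_zero i (s i) y hy
  refine (norm_sum_le _ _).trans ?_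
  calc _ = ∑ i ∈ J' ∩ J, ‖chartDerivLinear hφ k hx (u.toFun i (s i))‖ := by
        refine (Finset.sum_subset Finset.inter_subset_left fun i hi hi' => ?_).symm
        rw [hz i (fun h => hi' (Finset.mem_inter.2 ⟨hi, h⟩)), norm_zero]
    _ ≤ _ := Finset.sum_le_sum_of_subset_of_nonneg Finset.inter_subset_right
        fun _ _ _ => norm_nonneg _

end DeformationFamily

end ChartDerivatives

/-! ### Small parameters give small deformations in the Whitney topology. -/

section Approximation

variable {E H X V : Type*} [NormedAddCommGroup E] [NormedSpace ℝ E] [TopologicalSpace H]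
  {I : ModelWithCorners ℝ E H} [TopologicalSpace X] [ChartedSpace H X]
  [NormedAddCommGroup V] [NormedSpace ℝ V]

lemma mem_strongNhd_iff {f g : C^∞⟮I, X; 𝓘(ℝ, V), V⟯} {r : ℕ} {κ : Type}
    {φ : κ → OpenPartialHomeomorph X H} {K : κ → Set X} {ε : κ → ℝ} :
    g ∈ strongNhd I f r φ K ε ↔
      ∀ a, ∀ x ∈ K a, ∀ k ≤ r, ‖chartDeriv I (φ a) k g x - chartDeriv I (φ a) k f x‖ < ε a :=
  Iff.rfl

lemma exists_pos_forall_finite_le {κ : Type*} {S : Set κ} (hS : S.Finite) {b : κ → ℝ}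
    (hb : ∀ a ∈ S, 0 < b a) : ∃ δ, 0 < δ ∧ ∀ a ∈ S, δ ≤ b a := by
  have h : ∀ᶠ δ in 𝓝[>] (0 : ℝ), ∀ a ∈ S, δ ≤ b a :=
    (Filter.eventually_all_finite hS).2 fun a ha =>
      Filter.mem_of_superset (Ioo_mem_nhdsGT (hb a ha)) fun _ hδ => hδ.2.le
  obtain ⟨δ, hδ, hpos⟩ := (h.and self_mem_nhdsWithin).exists
  exact ⟨δ, hpos, hδ⟩

variable [I.Boundaryless]

/-- A basic open set of the Whitney topology contains a basic neighbourhood, of the same kind, of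
each of its points. -/
lemma exists_strongNhd_subset {f g : C^∞⟮I, X; 𝓘(ℝ, V), V⟯} {r : ℕ} {κ : Type}
    {φ : κ → OpenPartialHomeomorph X H} {K : κ → Set X} {ε : κ → ℝ}
    (hφ : ∀ a, φ a ∈ IsManifold.maximalAtlas I ∞ X)
    (hK : ∀ a, IsCompact (K a) ∧ K a ⊆ (φ a).source) (hg : g ∈ strongNhd I f r φ K ε) :
    ∃ δ : κ → ℝ, (∀ a, 0 < δ a) ∧ strongNhd I g r φ K δ ⊆ strongNhd I f r φ K ε := by
  rw [mem_strongNhd_iff] at hg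
  have key : ∀ a, ∀ k, k ≤ r → ∃ δ, 0 < δ ∧ ∀ x ∈ K a,
      ‖chartDeriv I (φ a) k g x - chartDeriv I (φ a) k f x‖ + δ ≤ ε a := by
    intro a k hk
    rcases (K a).eq_empty_or_nonempty with hne | hne
    · exact ⟨1, one_pos, by simp [hne]⟩
    have hc : ContinuousOn (fun x => ‖chartDeriv I (φ a) k g x - chartDeriv I (φ a) k f x‖) (K a) :=
      (((continuousOn_chartDeriv (hφ a) g.contMDiff k).sub
        (continuousOn_chartDeriv (hφ a) f.contMDiff k)).mono (hK a).2).norm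
    -- The maximum over the compact set is attained, hence still below `ε a`; the gap is the new
    -- tolerance.
    obtain ⟨x₀, hx₀, hmax⟩ := (hK a).1.exists_isMaxOn hne hc
    refine ⟨_, sub_pos.2 (hg a x₀ hx₀ k hk), fun x hx => ?_⟩
    have := hmax hx
    simp only [Set.mem_ofPred_eq] at this
    linarith
  have key' : ∀ a, ∃ δ, 0 < δ ∧ ∀ k ≤ r, ∀ x ∈ K a,
      ‖chartDeriv I (φ a) k g x - chartDeriv I (φ a) k f x‖ + δ ≤ ε a := by
    intro a
    choose! d hd hd' using key a
    obtain ⟨δ, hδ0, hδ⟩ := exists_pos_forall_finite_le (Set.finite_Iic r) hd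
    exact ⟨δ, hδ0, fun k hk x hx => by linarith [hd' k hk x hx, hδ k hk]⟩
  choose δ hδ hδ' using key'
  refine ⟨δ, hδ, fun h hh a x hx k hk => ?_⟩
  rw [mem_strongNhd_iff] at hh
  have h1 := hh a x hx k hk
  have h2 := hδ' a k hk x hx
  exact (norm_sub_le_norm_sub_add_norm_sub _ (chartDeriv I (φ a) k g x) _).trans_lt
    ((add_lt_add_of_lt_of_le h1 (le_sub_iff_add_le.2 h2)).trans_eq (by ring))

namespace DeformationFamily

variable {ι W : Type*} [NormedAddCommGroup W] [NormedSpace ℝ W]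
  (u : DeformationFamily X V I ι W)

lemma chartDeriv_add_sum {φ : OpenPartialHomeomorph X H}
    (hφ : φ ∈ IsManifold.maximalAtlas I ∞ X) {x : X} (hx : x ∈ φ.source)
    (f : C^∞⟮I, X; 𝓘(ℝ, V), V⟯) (s s' : ι → W) (k : ℕ) :
    chartDeriv I φ k (f + u.sum s : C^∞⟮I, X; 𝓘(ℝ, V), V⟯) x -
      chartDeriv I φ k (f + u.sum s' : C^∞⟮I, X; 𝓘(ℝ, V), V⟯) x =
    chartDeriv I φ k (u.sum (s - s')) x := by
  simp only [← chartDerivLinear_apply hφ k hx, u.sum_sub, map_add, map_sub]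
  abel

variable [FiniteDimensional ℝ W]

/-- The derivatives of the sum on a compact set depend continuously on the parameters. -/
lemma eventually_norm_chartDeriv_sub_lt {φ : OpenPartialHomeomorph X H}
    (hφ : φ ∈ IsManifold.maximalAtlas I ∞ X) {K : Set X} (hK : IsCompact K) (hKφ : K ⊆ φ.source)
    (f : C^∞⟮I, X; 𝓘(ℝ, V), V⟯) (s : ι → W) (r : ℕ) {ε : ℝ} (hε : 0 < ε) :
    ∀ᶠ s' in 𝓝 s, ∀ x ∈ K, ∀ k ≤ r,
      ‖chartDeriv I φ k (f + u.sum s' : C^∞⟮I, X; 𝓘(ℝ, V), V⟯) x -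
        chartDeriv I φ k (f + u.sum s : C^∞⟮I, X; 𝓘(ℝ, V), V⟯) x‖ < ε := by
  choose C hC hC' using fun i => exists_chartDeriv_le (u.toFun i) hφ hK hKφ r
  have hfin := u.locallyFinite.finite_nonempty_inter_compact hK
  have hcont : Continuous fun s' : ι → W => ∑ i ∈ hfin.toFinset, C i * ‖s' i - s i‖ := by fun_prop
  have h0 : (∑ i ∈ hfin.toFinset, C i * ‖s i - s i‖) < ε := by simpa using hε
  filter_upwards [hcont.continuousAt.eventually_lt continuousAt_const h0] with s' hs' x hx k hk
  rw [u.chartDeriv_add_sum hφ (hKφ hx)]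
  refine (u.norm_chartDeriv_sum_le hφ (hKφ hx) (J := hfin.toFinset) ?_ _ k).trans_lt
    (lt_of_le_of_lt (Finset.sum_le_sum fun i _ => hC' i _ x hx k hk) hs')
  intro i hi
  simpa using ⟨x, hi, hx⟩

/-- Each compact carrier meets only finitely many chart domains, so each parameter faces finitely
many constraints. Summable weights share out the tolerance `ε a` among the deformations. -/
lemma exists_forall_add_sum_mem_strongNhd [Countable ι] (f : C^∞⟮I, X; 𝓘(ℝ, V), V⟯) (r : ℕ)
    {κ : Type} {φ : κ → OpenPartialHomeomorph X H} {K : κ → Set X} {ε : κ → ℝ}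
    (hφ : ∀ a, φ a ∈ IsManifold.maximalAtlas I ∞ X)
    (hlf : LocallyFinite fun a => (φ a).source)
    (hK : ∀ a, IsCompact (K a) ∧ K a ⊆ (φ a).source) (hε : ∀ a, 0 < ε a) :
    ∃ η : ι → ℝ, (∀ i, 0 < η i) ∧
      ∀ s : ι → W, (∀ i, ‖s i‖ ≤ η i) → f + u.sum s ∈ strongNhd I f r φ K ε := by
  classical
  have : Encodable ι := Encodable.ofCountable ι
  choose C hC hC' using fun a i => exists_chartDeriv_le (u.toFun i) (hφ a) (hK a).1 (hK a).2 r
  have hfin := fun i => hlf.finite_nonempty_inter_compact (u.isCompact_carrier i)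
  -- Total weight `1 / 2` instead of `1` gives the strict inequality at the end.
  obtain ⟨w, hw, c, hc, hc1⟩ := posSumOfEncodable (ε := 1 / 2) (by norm_num) ι
  choose η hη hη' using fun i => exists_pos_forall_finite_le (hfin i)
    (b := fun a => ε a * w i / C a i) fun a _ => div_pos (mul_pos (hε a) (hw i)) (hC a i)
  refine ⟨η, hη, fun s hs => ?_⟩
  rw [mem_strongNhd_iff]
  intro a x hx k hk
  have hxφ := (hK a).2 hx
  have hdiff : chartDeriv I (φ a) k (f + u.sum s : C^∞⟮I, X; 𝓘(ℝ, V), V⟯) x -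
      chartDeriv I (φ a) k f x = chartDeriv I (φ a) k (u.sum s) x := by
    simp only [← chartDerivLinear_apply (hφ a) k hxφ, map_add]
    abel
  rw [hdiff]
  have hx_fin := u.locallyFinite.point_finite x
  have hterm : ∀ i ∈ hx_fin.toFinset,
      ‖chartDeriv I (φ a) k (u.toFun i (s i)) x‖ ≤ ε a * w i := by
    intro i hi
    have hxi : x ∈ u.carrier i := by simpa using hi
    have h1 := hη' i a ⟨x, hxφ, hxi⟩
    rw [le_div_iff₀ (hC a i)] at h1
    calc _ ≤ C a i * ‖s i‖ := hC' a i _ x hx k hk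
      _ ≤ C a i * η i := by gcongr; exacts [(hC a i).le, hs i]
      _ ≤ _ := by linarith
  calc _ ≤ _ := u.norm_chartDeriv_sum_le (hφ a) hxφ (J := hx_fin.toFinset) (by simp) s k
    _ ≤ ∑ i ∈ hx_fin.toFinset, ε a * w i := Finset.sum_le_sum hterm
    _ = ε a * ∑ i ∈ hx_fin.toFinset, w i := by rw [Finset.mul_sum]
    _ ≤ ε a * (1 / 2) := by
        gcongr
        · exact (hε a).le
        · exact (sum_le_hasSum _ (fun i _ => (hw i).le) hc).trans hc1
    _ < ε a := by linarith [hε a]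

/-- Induction on the generation of the topology: the property passes to finite intersections by
taking minima of radii, and to unions trivially. -/
lemma exists_forall_add_sum_mem [Countable ι] (f : C^∞⟮I, X; 𝓘(ℝ, V), V⟯)
    {N : Set C^∞⟮I, X; 𝓘(ℝ, V), V⟯} (hN : IsOpen[whitneyTopology I] N) (hf : f ∈ N) :
    ∃ η : ι → ℝ, (∀ i, 0 < η i) ∧ ∀ s : ι → W, (∀ i, ‖s i‖ ≤ η i) → f + u.sum s ∈ N := by
  change TopologicalSpace.GenerateOpen _ N at hN
  induction hN with
  | basic N hN =>
    obtain ⟨f₀, r, κ, φ, K, ε, hφ, hlf, hK, hε, rfl⟩ := hN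
    obtain ⟨δ, hδ, hsub⟩ := exists_strongNhd_subset hφ hK hf
    obtain ⟨η, hη, h⟩ := u.exists_forall_add_sum_mem_strongNhd f r hφ hlf hK hδ
    exact ⟨η, hη, fun s hs => hsub (h s hs)⟩
  | univ => exact ⟨1, fun _ => one_pos, fun _ _ => trivial⟩
  | inter N N' _ _ ih ih' =>
    obtain ⟨η, hη, h⟩ := ih hf.1
    obtain ⟨η', hη', h'⟩ := ih' hf.2
    exact ⟨fun i => min (η i) (η' i), fun i => lt_min (hη i) (hη' i), fun s hs =>
      ⟨h s fun i => (hs i).trans (min_le_left _ _), h' s fun i => (hs i).trans (min_le_right _ _)⟩⟩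
  | sUnion S _ ih =>
    obtain ⟨N, hN, hfN⟩ := hf
    obtain ⟨η, hη, h⟩ := ih N hN hfN
    exact ⟨η, hη, fun s hs => ⟨N, hN, h s hs⟩⟩

end DeformationFamily

end Approximation

/-! ### The derivative along the fibre at the zero section, and its stability. -/

section FiberDerivative

variable {n : ℕ} {M : Type*} [TopologicalSpace M] [ChartedSpace (EuclideanSpace ℝ (Fin n)) M]
  [IsManifold (𝓡 n) ∞ M]

/-- The zero vector at `x`, as a point of the tangent bundle. -/
def zeroVec (n : ℕ) {M : Type*} [TopologicalSpace M] [ChartedSpace (EuclideanSpace ℝ (Fin n)) M]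
    [IsManifold (𝓡 n) ∞ M] (x : M) : TangentBundle (𝓡 n) M := ⟨x, 0⟩

lemma continuous_zeroVec : Continuous (zeroVec n : M → TangentBundle (𝓡 n) M) :=
  (Bundle.contMDiff_zeroSection (n := ∞) (IB := 𝓡 n) ℝ (TangentSpace (𝓡 n) : M → Type _)).continuous

/-- The chart of the tangent bundle induced by the preferred chart of `M` at `c`. -/
def tangentChart (n : ℕ) {M : Type*} [TopologicalSpace M]
    [ChartedSpace (EuclideanSpace ℝ (Fin n)) M] [IsManifold (𝓡 n) ∞ M] (c : M) :
    OpenPartialHomeomorph (TangentBundle (𝓡 n) M)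
      (ModelProd (EuclideanSpace ℝ (Fin n)) (EuclideanSpace ℝ (Fin n))) :=
  chartAt _ (zeroVec n c)

/-- The coordinates on the tangent bundle induced by the preferred chart of `M` at `c`. -/
def tangentCoord (n : ℕ) {M : Type*} [TopologicalSpace M]
    [ChartedSpace (EuclideanSpace ℝ (Fin n)) M] [IsManifold (𝓡 n) ∞ M] (c : M) :
    PartialEquiv (TangentBundle (𝓡 n) M)
      (EuclideanSpace ℝ (Fin n) × EuclideanSpace ℝ (Fin n)) :=
  (tangentChart n c).extend (𝓡 n).tangent

lemma tangentChart_mem_maximalAtlas (c : M) :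
    tangentChart n c ∈ IsManifold.maximalAtlas (𝓡 n).tangent ∞ (TangentBundle (𝓡 n) M) :=
  IsManifold.chart_mem_maximalAtlas _

lemma tangentCoord_eq (c : M) : tangentCoord n c = extChartAt (𝓡 n).tangent (zeroVec n c) := rfl

lemma mem_tangentChart_source {c : M} {p : TangentBundle (𝓡 n) M} :
    p ∈ (tangentChart n c).source ↔ p.proj ∈ (chartAt (EuclideanSpace ℝ (Fin n)) c).source :=
  TangentBundle.mem_chart_source_iff _ _

lemma tangentCoord_source (c : M) : (tangentCoord n c).source = (tangentChart n c).source :=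
  OpenPartialHomeomorph.extend_source _

lemma tangentCoord_snd (c : M) (p : TangentBundle (𝓡 n) M) :
    (tangentCoord n c p).2 = (trivializationAt (EuclideanSpace ℝ (Fin n))
      (TangentSpace (𝓡 n) : M → Type _) c p).2 := rfl

lemma tangentCoord_zeroVec {c x : M} (hx : x ∈ (chartAt (EuclideanSpace ℝ (Fin n)) c).source) :
    tangentCoord n c (zeroVec n x) = (extChartAt (𝓡 n) c x, 0) := by
  refine Prod.ext rfl ?_
  rw [tangentCoord_snd]
  have := (trivializationAt (EuclideanSpace ℝ (Fin n))
      (TangentSpace (𝓡 n) : M → Type _) c).zeroSection ℝ (x := x) hx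
  exact congrArg Prod.snd this

lemma mem_tangentCoord_target {c : M} {z : EuclideanSpace ℝ (Fin n) × EuclideanSpace ℝ (Fin n)} :
    z ∈ (tangentCoord n c).target ↔ z.1 ∈ (extChartAt (𝓡 n) c).target := by
  rw [tangentCoord_eq]
  erw [FiberBundle.extChartAt_target (IB := 𝓡 n) (zeroVec n c)]
  simp only [Set.mem_prod, Set.mem_inter_iff, Set.mem_preimage, Set.mem_univ, and_true]
  refine ⟨And.left, fun hz => ⟨hz, ?_⟩⟩
  have := (extChartAt (𝓡 n) c).map_target hz
  rwa [extChartAt_source] at this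

lemma tangentCoord_symm_proj {c : M} {z : EuclideanSpace ℝ (Fin n) × EuclideanSpace ℝ (Fin n)} :
    ((tangentCoord n c).symm z).proj = (extChartAt (𝓡 n) c).symm z.1 := by
  rfl

lemma contMDiffOn_tangentCoord (c : M) :
    ContMDiffOn (𝓡 n).tangent 𝓘(ℝ, EuclideanSpace ℝ (Fin n) × EuclideanSpace ℝ (Fin n)) ∞
      (tangentCoord n c) (tangentChart n c).source :=
  contMDiffOn_extChartAt

/-- The system `F` in the coordinates `(x, v)` induced by the preferred chart of `M` at `c`. -/
def coordRep (c : M) (F : System n M) :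
    EuclideanSpace ℝ (Fin n) × EuclideanSpace ℝ (Fin n) → EuclideanSpace ℝ (Fin n) :=
  F ∘ (tangentCoord n c).symm

lemma contDiffOn_coordRep (c : M) (F : System n M) :
    ContDiffOn ℝ ∞ (coordRep c F) (tangentCoord n c).target :=
  contDiffOn_comp_extend_symm (tangentChart_mem_maximalAtlas c) F.contMDiff

lemma isOpen_tangentCoord_target (c : M) : IsOpen (tangentCoord n c).target :=
  (tangentChart n c).isOpen_extend_target

lemma contDiffAt_coordRep {c : M} (F : System n M)
    {z : EuclideanSpace ℝ (Fin n) × EuclideanSpace ℝ (Fin n)}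
    (hz : z ∈ (tangentCoord n c).target) : ContDiffAt ℝ ∞ (coordRep c F) z :=
  (contDiffOn_coordRep c F).contDiffAt ((isOpen_tangentCoord_target c).mem_nhds hz)

lemma zero_mem_tangentCoord_target {c x : M}
    (hx : x ∈ (chartAt (EuclideanSpace ℝ (Fin n)) c).source) :
    (extChartAt (𝓡 n) c x, (0 : EuclideanSpace ℝ (Fin n))) ∈ (tangentCoord n c).target :=
  mem_tangentCoord_target.2 ((extChartAt (𝓡 n) c).map_source (by rwa [extChartAt_source]))

lemma coordRep_zero {c x : M} (hx : x ∈ (chartAt (EuclideanSpace ℝ (Fin n)) c).source)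
    (F : System n M) : coordRep c F (extChartAt (𝓡 n) c x, 0) = F (zeroVec n x) := by
  rw [coordRep, Function.comp_apply, ← tangentCoord_zeroVec hx, (tangentCoord n c).left_inv]
  rw [tangentCoord_source]
  exact mem_tangentChart_source.2 hx

/-- The derivative of `F` along the fibre at the zero vector over `x`, in the coordinates induced by
the preferred chart of `M` at `c`. -/
def fiberDeriv (c : M) (F : System n M) (x : M) :
    EuclideanSpace ℝ (Fin n) →L[ℝ] EuclideanSpace ℝ (Fin n) :=
  (fderiv ℝ (coordRep c F) (extChartAt (𝓡 n) c x, 0)).comp (ContinuousLinearMap.inr ℝ _ _)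

lemma fiberDeriv_add {c x : M} (hx : x ∈ (chartAt (EuclideanSpace ℝ (Fin n)) c).source)
    (F G : System n M) : fiberDeriv c (F + G) x = fiberDeriv c F x + fiberDeriv c G x := by
  have h : fderiv ℝ (coordRep c (F + G)) (extChartAt (𝓡 n) c x, 0) = _ :=
    fderiv_add (f := coordRep c F) (g := coordRep c G)
    ((contDiffAt_coordRep F (zero_mem_tangentCoord_target hx)).differentiableAt (by simp))
    ((contDiffAt_coordRep G (zero_mem_tangentCoord_target hx)).differentiableAt (by simp))
  rw [fiberDeriv, h, ContinuousLinearMap.add_comp]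
  rfl

lemma fiberDeriv_sub {c x : M} (hx : x ∈ (chartAt (EuclideanSpace ℝ (Fin n)) c).source)
    (F G : System n M) : fiberDeriv c (F - G) x = fiberDeriv c F x - fiberDeriv c G x := by
  rw [eq_sub_iff_add_eq, ← fiberDeriv_add hx, sub_add_cancel]

/-- The fibre derivative as a function of the coordinates of the base point is continuous. -/
lemma continuousOn_fderiv_coordRep (c : M) (F : System n M) :
    ContinuousOn (fun y => (fderiv ℝ (coordRep c F) (y, 0)).comp
      (ContinuousLinearMap.inr ℝ (EuclideanSpace ℝ (Fin n)) (EuclideanSpace ℝ (Fin n))))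
      (extChartAt (𝓡 n) c).target := by
  have h := (contDiffOn_coordRep c F).continuousOn_fderiv_of_isOpen (isOpen_tangentCoord_target c)
    (by simp)
  have h' := h.comp (g := fderiv ℝ (coordRep c F))
    (f := fun y : EuclideanSpace ℝ (Fin n) => (y, (0 : EuclideanSpace ℝ (Fin n))))
    (s := (extChartAt (𝓡 n) c).target) (by fun_prop) fun y hy => mem_tangentCoord_target.2 hy
  exact h'.clm_comp continuousOn_const

lemma continuousOn_fiberDeriv (c : M) (F : System n M) :
    ContinuousOn (fiberDeriv c F) (chartAt (EuclideanSpace ℝ (Fin n)) c).source := by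
  have h := continuousOn_extChartAt (I := 𝓡 n) c
  rw [extChartAt_source] at h
  exact (continuousOn_fderiv_coordRep c F).comp h
    fun x hx => (extChartAt (𝓡 n) c).map_source (by rwa [extChartAt_source])

/-- The system is regular at the zero vector over `x`, in the coordinates induced by the preferred
chart of `M` at `c`: if this vector lies on the system surface, then the fibre derivative is
invertible. -/
def IsRegularZero (c : M) (F : System n M) (x : M) : Prop :=
  F (zeroVec n x) = 0 → (fiberDeriv c F x).det ≠ 0

/-- Regularity over a compact set is stable under `C¹`-small deformations. -/
lemma exists_forall_isRegularZero {c : M} {K : Set M} (hK : IsCompact K)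
    (hKc : K ⊆ (chartAt (EuclideanSpace ℝ (Fin n)) c).source) {F : System n M}
    (hF : ∀ x ∈ K, IsRegularZero c F x) :
    ∃ ε > 0, ∀ G : System n M,
      (∀ p ∈ zeroVec n '' K, ∀ k ≤ 1, ‖chartDeriv (𝓡 n).tangent (tangentChart n c) k G p -
        chartDeriv (𝓡 n).tangent (tangentChart n c) k F p‖ < ε) →
      ∀ x ∈ K, IsRegularZero c G x := by
  let E := EuclideanSpace ℝ (Fin n)
  let j : System n M → M → E × (E →L[ℝ] E) := fun G x => (G (zeroVec n x), fiberDeriv c G x)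
  -- The regular pairs (value, fibre derivative) form an open set; it contains a thickening of the
  -- compact image of `K`.
  let O : Set (E × (E →L[ℝ] E)) := {a | a.1 ≠ 0} ∪ {a | a.2.det ≠ 0}
  have hO : IsOpen O := (isOpen_ne_fun continuous_fst continuous_const).union
    (isOpen_ne_fun (ContinuousLinearMap.continuous_det.comp continuous_snd) continuous_const)
  have hmem : ∀ G x, j G x ∈ O ↔ IsRegularZero c G x := by
    intro G x
    simp only [j, O, IsRegularZero, Set.mem_union, Set.mem_ofPred_eq]
    tauto
  have hj : ContinuousOn (j F) K :=
    (F.contMDiff.continuous.comp continuous_zeroVec).continuousOn.prodMk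
      ((continuousOn_fiberDeriv c F).mono hKc)
  obtain ⟨ε, hε, hsub⟩ := (hK.image_of_continuousOn hj).exists_thickening_subset_open hO
    (by rintro _ ⟨x, hx, rfl⟩; exact (hmem F x).2 (hF x hx))
  refine ⟨ε, hε, fun G hG x hx => (hmem G x).1 (hsub ?_)⟩
  have hxs : zeroVec n x ∈ (tangentChart n c).source := mem_tangentChart_source.2 (hKc hx)
  have hdiff : ∀ k ≤ 1, ‖chartDeriv (𝓡 n).tangent (tangentChart n c) k (G - F : System n M)
      (zeroVec n x)‖ < ε := by
    intro k hk
    have := hG _ ⟨x, hx, rfl⟩ k hk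
    simp only [← chartDerivLinear_apply (tangentChart_mem_maximalAtlas c) k hxs] at this ⊢
    rwa [map_sub]
  have hcoord : (tangentChart n c).extend (𝓡 n).tangent (zeroVec n x) =
    (extChartAt (𝓡 n) c x, 0) := tangentCoord_zeroVec (hKc hx)
  refine Metric.mem_thickening_iff.2 ⟨j F x, ⟨x, hx, rfl⟩, ?_⟩
  rw [Prod.dist_eq, max_lt_iff, dist_eq_norm, dist_eq_norm]
  constructor
  · have h0 := hdiff 0 zero_le_one
    rw [chartDeriv, norm_iteratedFDeriv_zero, hcoord] at h0
    exact (congrArg norm (coordRep_zero (hKc hx) (G - F))).symm.trans_lt h0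
  · have h1 := hdiff 1 le_rfl
    rw [chartDeriv, norm_iteratedFDeriv_one, hcoord] at h1
    change ‖fiberDeriv c G x - fiberDeriv c F x‖ < ε
    rw [← fiberDeriv_sub (hKc hx)]
    refine lt_of_le_of_lt ?_ h1
    refine (ContinuousLinearMap.opNorm_comp_le _ _).trans ?_
    exact mul_le_of_le_one_right (norm_nonneg _) (ContinuousLinearMap.norm_inr_le_one _ _ _)

end FiberDerivative

/-! ### Regular zeros are not critical, and nonzero velocities persist nearby. -/

/-- If `A` is invertible along the second factor, then its kernel projects isomorphically onto the
first factor. The statement is invariant under coordinate changes `D` and `Q`. -/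
lemma bijective_ker_of_bijective_inr {T T' Y Z Z' : Type*} [AddCommGroup T] [Module ℝ T]
    [AddCommGroup T'] [Module ℝ T'] [AddCommGroup Y] [Module ℝ Y] [AddCommGroup Z] [Module ℝ Z]
    [AddCommGroup Z'] [Module ℝ Z'] (L : T →ₗ[ℝ] Z') (P : T →ₗ[ℝ] T') (D : T →ₗ[ℝ] Y × Z)
    (Q : T' →ₗ[ℝ] Y) (A : Y × Z →ₗ[ℝ] Z') (hD : Function.Bijective D) (hQ : Function.Injective Q)
    (hL : ∀ w, L w = A (D w)) (hP : ∀ w, Q (P w) = (D w).1)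
    (hA : Function.Bijective (A ∘ₗ LinearMap.inr ℝ Y Z)) :
    Function.Bijective (fun w : LinearMap.ker L => P w.1) := by
  constructor
  · rintro ⟨w, hw⟩ ⟨w', hw'⟩ h
    simp only at h
    rw [LinearMap.mem_ker, hL] at hw hw'
    have h1 : (D w).1 = (D w').1 := by rw [← hP, ← hP, h]
    have h2 : D w - D w' = LinearMap.inr ℝ Y Z ((D w).2 - (D w').2) := by
      ext <;> simp [h1]
    have h3 : (A ∘ₗ LinearMap.inr ℝ Y Z) ((D w).2 - (D w').2) = 0 := by
      rw [LinearMap.comp_apply, ← h2, map_sub, hw, hw', sub_zero]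
    have h4 : (D w).2 - (D w').2 = 0 := hA.1 (by rw [h3, map_zero])
    exact Subtype.ext (hD.1 (Prod.ext h1 (sub_eq_zero.1 h4)))
  · intro z
    -- The vertical correction `e` brings the lift `(Q z, 0)` into the kernel without changing its
    -- first coordinate.
    obtain ⟨e, he⟩ := hA.2 (-A (Q z, 0))
    obtain ⟨w, hw⟩ := hD.2 (Q z, e)
    refine ⟨⟨w, ?_⟩, hQ ?_⟩
    · rw [LinearMap.mem_ker, hL, hw]
      have : (Q z, e) = (Q z, 0) + LinearMap.inr ℝ Y Z e := by simp
      rw [this, map_add]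
      rw [LinearMap.comp_apply] at he
      rw [he, add_neg_cancel]
    · rw [hP, hw]

variable {n : ℕ} {M : Type*} [TopologicalSpace M] [ChartedSpace (EuclideanSpace ℝ (Fin n)) M]
  [IsManifold (𝓡 n) ∞ M]

/-- A regular zero vector on the system surface is not a critical point of the folding. -/
lemma IsRegularZero.not_isCriticalPoint {c : M} {F : System n M} {p : surface F}
    (hp : p.1.proj ∈ (chartAt (EuclideanSpace ℝ (Fin n)) c).source) (hp0 : p.1 = zeroVec n p.1.proj)
    (h : IsRegularZero c F p.1.proj) : ¬ IsCriticalPoint F p := by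
  obtain ⟨⟨x, v⟩, hpF⟩ := p
  obtain rfl : v = 0 := by
    rw [Bundle.TotalSpace.mk.injEq] at hp0
    exact eq_of_heq hp0.2
  rw [IsCriticalPoint, not_not]
  change x ∈ _ at hp
  have hpF0 : F (zeroVec n x) = 0 := hpF
  have hdet := h hpF0
  have hsrc : zeroVec n x ∈ (extChartAt (𝓡 n).tangent (zeroVec n c)).source := by
    rw [extChartAt_source]
    exact mem_tangentChart_source.2 hp
  have hsrc' : x ∈ (extChartAt (𝓡 n) c).source := by rwa [extChartAt_source]
  have hbij : Function.Bijective (fiberDeriv c F x) := by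
    have hu := (LinearMap.isUnit_iff_isUnit_det _).2 (isUnit_iff_ne_zero.2 hdet)
    exact (Module.End.isUnit_iff _).1 hu
  have hcoord := tangentCoord_zeroVec hp
  have hD : HasMFDerivAt (𝓡 n).tangent
      𝓘(ℝ, EuclideanSpace ℝ (Fin n) × EuclideanSpace ℝ (Fin n)) (tangentCoord n c)
      (zeroVec n x) _ :=
    (mdifferentiableAt_extChartAt (mem_tangentChart_source.2 hp)).hasMFDerivAt
  have hDinv := isInvertible_mfderiv_extChartAt (I := (𝓡 n).tangent) hsrc
  have hQ : HasMFDerivAt (𝓡 n) 𝓘(ℝ, EuclideanSpace ℝ (Fin n)) (extChartAt (𝓡 n) c) x _ :=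
    (mdifferentiableAt_extChartAt hp).hasMFDerivAt
  have hQinv := isInvertible_mfderiv_extChartAt (I := 𝓡 n) hsrc'
  have hP : HasMFDerivAt (𝓡 n).tangent (𝓡 n)
      (Bundle.TotalSpace.proj : TangentBundle (𝓡 n) M → M) (zeroVec n x) _ :=
    (Bundle.mdifferentiableAt_proj _).hasMFDerivAt
  have hA : HasFDerivAt (coordRep c F) (fderiv ℝ (coordRep c F) (extChartAt (𝓡 n) c x, 0))
      (tangentCoord n c (zeroVec n x)) := by
    rw [hcoord]
    exact ((contDiffAt_coordRep F
      (zero_mem_tangentCoord_target hp)).differentiableAt (by simp)).hasFDerivAt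
  have hev : F =ᶠ[𝓝 (zeroVec n x)] coordRep c F ∘ tangentCoord n c := by
    filter_upwards [extChartAt_source_mem_nhds' hsrc] with q hq
    rw [Function.comp_apply, coordRep, Function.comp_apply, (tangentCoord n c).left_inv hq]
  have hF :=
    ((HasMFDerivAt.comp (zeroVec n x) hA.hasMFDerivAt hD).congr_of_eventuallyEq hev).mfderiv
  have hfst : HasMFDerivAt 𝓘(ℝ, EuclideanSpace ℝ (Fin n) × EuclideanSpace ℝ (Fin n))
      𝓘(ℝ, EuclideanSpace ℝ (Fin n)) Prod.fst (tangentCoord n c (zeroVec n x)) _ :=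
    (hasFDerivAt_fst (𝕜 := ℝ)).hasMFDerivAt
  have hfstD := HasMFDerivAt.comp (zeroVec n x) hfst hD
  -- In the induced coordinates the bundle projection is the first projection; differentiate both
  -- expressions of this composite.
  have hPQ := hasMFDerivAt_unique (HasMFDerivAt.comp (zeroVec n x) hQ hP) hfstD
  exact bijective_ker_of_bijective_inr _ _ (mfderiv (𝓡 n).tangent
    𝓘(ℝ, EuclideanSpace ℝ (Fin n) × EuclideanSpace ℝ (Fin n)) (tangentCoord n c)
    (zeroVec n x)).toLinearMap
    (mfderiv (𝓡 n) 𝓘(ℝ, EuclideanSpace ℝ (Fin n)) (extChartAt (𝓡 n) c) x).toLinearMap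
    (fderiv ℝ (coordRep c F) (extChartAt (𝓡 n) c x, 0)).toLinearMap hDinv.bijective
    hQinv.bijective.1 (fun w => DFunLike.congr_fun hF w) (fun w => DFunLike.congr_fun hPQ w) hbij

/-- The velocity is nonzero in a neighbourhood of each nonzero vector. -/
lemma eventually_oneFolding_dom {F : System n M} {p : surface F}
    (hp : p.1 ∉ Set.range (Bundle.zeroSection (EuclideanSpace ℝ (Fin n))
      (TangentSpace (𝓡 n) : M → Type _))) :
    ∀ᶠ q in 𝓝 p, (oneFolding F q).Dom := by
  have hsrc : p.1 ∈ (tangentChart n p.1.proj).source :=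
    mem_tangentChart_source.2 (mem_chart_source _ _)
  have hcont : ContinuousAt (tangentCoord n p.1.proj) p.1 :=
    (tangentChart n p.1.proj).continuousAt_extend hsrc
  have hinj := (tangentCoord n p.1.proj).injOn
  have hne : (tangentCoord n p.1.proj p.1).2 ≠ 0 := by
    intro h0
    refine hp ⟨p.1.proj, ?_⟩
    refine hinj (x₁ := zeroVec n p.1.proj) ?_ ?_ ?_
    · rw [tangentCoord_source]
      exact mem_tangentChart_source.2 (mem_chart_source _ _)
    · rwa [tangentCoord_source]
    · rw [tangentCoord_zeroVec (mem_chart_source _ _)]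
      exact Prod.ext rfl h0.symm
  have hev : ∀ᶠ q in 𝓝 p.1, (tangentCoord n p.1.proj q).2 ≠ 0 ∧
      q ∈ (tangentChart n p.1.proj).source :=
    ((continuous_snd.continuousAt.comp hcont).eventually_ne hne).and
      ((tangentChart n p.1.proj).open_source.mem_nhds hsrc)
  filter_upwards [continuousAt_subtype_val.eventually hev] with q hq
  intro h0
  refine hq.1 ?_
  have hq0 : q.1 = zeroVec n q.1.proj := by
    rw [zeroVec, ← h0]
  rw [hq0, tangentCoord_zeroVec (mem_tangentChart_source.1 hq.2)]

/-! ### The measure-theoretic transversality argument. -/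

section Shift

open MeasureTheory

/-- The determinant vanishes only when `-t` is an eigenvalue of `A`. -/
lemma finite_setOf_det_add_smul_eq_zero {E : Type*} [NormedAddCommGroup E] [NormedSpace ℝ E]
    [FiniteDimensional ℝ E] (A : E →L[ℝ] E) :
    {t : ℝ | (A + t • ContinuousLinearMap.id ℝ E).det = 0}.Finite := by
  have h := (Module.End.finite_spectrum (A : E →ₗ[ℝ] E)).preimage
    (f := fun t : ℝ => -t) neg_injective.injOn
  refine h.subset fun t ht => ?_
  rw [Set.mem_preimage, spectrum.mem_iff, ← IsUnit.neg_iff]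
  intro hu
  have := LinearMap.isUnit_iff_isUnit_det _ |>.1 hu
  refine this.ne_zero ?_
  rw [← ht]
  unfold ContinuousLinearMap.det
  congr 1
  ext x
  simp [Algebra.algebraMap_eq_smul_one]

/-- For a differentiable map `f` and a continuous field `B` of linear maps on a compact set, almost
all shifts of `f` and `B` have no common zero of `f` and `det B`. -/
lemma exists_shift_det_ne_zero {E : Type*} [NormedAddCommGroup E] [NormedSpace ℝ E]
    [FiniteDimensional ℝ E] {f : E → E} {B : E → E →L[ℝ] E} {K : Set E} (hK : IsCompact K)
    (hf : DifferentiableOn ℝ f K) (hB : ContinuousOn B K) {O : Set (ℝ × E)} (hO : IsOpen O)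
    (hne : O.Nonempty) :
    ∃ w ∈ O, ∀ y ∈ K, f y + w.2 = 0 → (B y + w.1 • ContinuousLinearMap.id ℝ E).det ≠ 0 := by
  borelize E
  let μ : Measure E := Measure.addHaar
  obtain ⟨⟨t₀, c₀⟩, h₀⟩ := hne
  obtain ⟨T, C, hT, hC, ht₀, hc₀, hTC⟩ := isOpen_prod_iff.1 hO t₀ c₀ h₀
  let S : Set (E × ℝ) := (K ×ˢ Set.univ) ∩
    (fun p => (B p.1 + p.2 • ContinuousLinearMap.id ℝ E).det) ⁻¹' {0}
  have hcont : ContinuousOn (fun p : E × ℝ => (B p.1 + p.2 • ContinuousLinearMap.id ℝ E).det)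
      (K ×ˢ Set.univ) := by
    refine ContinuousLinearMap.continuous_det.comp_continuousOn ?_
    exact (hB.comp continuousOn_fst fun p hp => hp.1).add
      (continuous_snd.smul continuous_const).continuousOn
  have hS : MeasurableSet S := (hcont.preimage_isClosed_of_isClosed
    (hK.isClosed.prod isClosed_univ) isClosed_singleton).measurableSet
  -- Fubini in both orders: the slices over `y` are finite, so `S` is null, so almost every slice
  -- over `t` is null.
  have hSnull : (μ.prod volume) S = 0 := by
    rw [Measure.measure_prod_null hS]
    refine Filter.Eventually.of_forall fun y => ?_
    refine ((finite_setOf_det_add_smul_eq_zero (B y)).subset ?_).measure_zero _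
    intro t ht
    exact ht.2
  have hae : ∀ᵐ t ∂(volume : Measure ℝ), μ ((fun y => (y, t)) ⁻¹' S) = 0 := by
    have : (Measure.prod (volume : Measure ℝ) μ) (Prod.swap ⁻¹' S) = 0 := by
      rw [← Measure.prod_swap] at hSnull
      rwa [Measure.map_apply measurable_swap hS] at hSnull
    exact (Measure.measure_prod_null (measurable_swap hS)).1 this
  obtain ⟨t, htT, ht⟩ : ∃ t ∈ T, μ ((fun y => (y, t)) ⁻¹' S) = 0 := by
    by_contra! h
    have h0 : volume T = 0 := measure_mono_null (fun t htT => h t htT) hae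
    exact (hT.measure_pos volume ⟨t₀, ht₀⟩).ne' h0
  -- Source and target have the same dimension, so the differentiable `f` maps null sets to null
  -- sets. It remains to choose `-c` off this image.
  have himg : μ (f '' ((fun y => (y, t)) ⁻¹' S)) = 0 :=
    addHaar_image_eq_zero_of_differentiableOn_of_addHaar_eq_zero μ
      (hf.mono fun y hy => hy.1.1) ht
  obtain ⟨c, hcC, hc⟩ : ∃ c ∈ C, -c ∉ f '' ((fun y => (y, t)) ⁻¹' S) := by
    by_contra! h
    have h0 : μ C = 0 := by
      rw [← Measure.measure_preimage_neg]
      exact measure_mono_null (fun c hc => by simpa using h (-c) hc) himg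
    exact (hC.measure_pos μ ⟨c₀, hc₀⟩).ne' h0
  refine ⟨(t, c), hTC ⟨htT, hcC⟩, fun y hy hfy hdet => hc ⟨y, ⟨⟨hy, trivial⟩, hdet⟩, ?_⟩⟩
  exact eq_neg_of_add_eq_zero_left hfy

end Shift

/-! ### The explicit deformations and the properness of the deformed folding. -/

section Deformation

variable {n : ℕ} {M : Type*} [TopologicalSpace M] [T2Space M]
  [ChartedSpace (EuclideanSpace ℝ (Fin n)) M] [IsManifold (𝓡 n) ∞ M]

/-- The cut-off function of the velocity. -/
def velocityBump (n : ℕ) : ContDiffBump (0 : EuclideanSpace ℝ (Fin n)) :=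
  ⟨1, 2, one_pos, one_lt_two⟩

/-- The deformation `f(x) ρ(v) (b + t v)`, in the coordinates `(x, v)` induced by the chart at `c`,
where `f` is a bump function in this chart and `ρ` is a cut-off function of the velocity. -/
def bumpDeformationFun {c : M} (f : SmoothBumpFunction (𝓡 n) c)
    (w : ℝ × EuclideanSpace ℝ (Fin n)) (p : TangentBundle (𝓡 n) M) : EuclideanSpace ℝ (Fin n) :=
  f p.proj • velocityBump n (tangentCoord n c p).2 • (w.2 + w.1 • (tangentCoord n c p).2)

lemma contMDiff_bumpDeformationFun {c : M} (f : SmoothBumpFunction (𝓡 n) c)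
    (w : ℝ × EuclideanSpace ℝ (Fin n)) :
    ContMDiff (𝓡 n).tangent 𝓘(ℝ, EuclideanSpace ℝ (Fin n)) ∞ (bumpDeformationFun f w) := by
  intro p
  by_cases hp : p.proj ∈ tsupport f
  · have hsrc : p ∈ (tangentChart n c).source :=
      mem_tangentChart_source.2 (f.tsupport_subset_chartAt_source hp)
    have hf : ContMDiffAt (𝓡 n).tangent 𝓘(ℝ) ∞ (fun p : TangentBundle (𝓡 n) M => f p.proj) p :=
      f.contMDiff.contMDiffAt.comp p (Bundle.contMDiffAt_proj _)
    have hcoord := (contMDiffOn_tangentCoord c).contMDiffAt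
      ((tangentChart n c).open_source.mem_nhds hsrc)
    have hv : ContDiff ℝ ∞ fun z : EuclideanSpace ℝ (Fin n) × EuclideanSpace ℝ (Fin n) =>
        velocityBump n z.2 • (w.2 + w.1 • z.2) :=
      ((velocityBump n).contDiff.comp contDiff_snd).smul
        (contDiff_const.add (contDiff_snd.const_smul w.1))
    exact hf.smul (hv.contMDiff.contMDiffAt.comp p hcoord)
  · have : bumpDeformationFun f w =ᶠ[𝓝 p] fun _ => 0 := by
      have hcont : Continuous (Bundle.TotalSpace.proj : TangentBundle (𝓡 n) M → M) :=
        FiberBundle.continuous_proj _ _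
      filter_upwards [(isClosed_tsupport f).isOpen_compl.preimage hcont |>.mem_nhds hp] with q hq
      rw [bumpDeformationFun, image_eq_zero_of_notMem_tsupport hq, zero_smul]
    exact contMDiffAt_const.congr_of_eventuallyEq this

/-- The deformation `f(x) ρ(v) (b + t v)` as a linear map of the parameter `(t, b)`. -/
def bumpDeformation {c : M} (f : SmoothBumpFunction (𝓡 n) c) :
    ℝ × EuclideanSpace ℝ (Fin n) →ₗ[ℝ] System n M where
  toFun w := ⟨bumpDeformationFun f w, contMDiff_bumpDeformationFun f w⟩
  map_add' w w' := by
    ext1 p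
    change bumpDeformationFun f (w + w') p = bumpDeformationFun f w p + bumpDeformationFun f w' p
    simp only [bumpDeformationFun, ← smul_add, Prod.fst_add, Prod.snd_add, add_smul]
    congr 2
    abel
  map_smul' a w := by
    ext1 p
    change bumpDeformationFun f (a • w) p = a • bumpDeformationFun f w p
    simp only [bumpDeformationFun, Prod.smul_fst, Prod.smul_snd, smul_eq_mul, mul_smul,
      ← smul_add]
    rw [smul_comm a, smul_comm a]

lemma bumpDeformation_apply {c : M} (f : SmoothBumpFunction (𝓡 n) c)
    (w : ℝ × EuclideanSpace ℝ (Fin n)) (p : TangentBundle (𝓡 n) M) :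
    bumpDeformation f w p = f p.proj • velocityBump n (tangentCoord n c p).2 •
      (w.2 + w.1 • (tangentCoord n c p).2) := rfl

/-- A compact set outside which the deformations vanish. -/
def bumpCarrier {c : M} (f : SmoothBumpFunction (𝓡 n) c) : Set (TangentBundle (𝓡 n) M) :=
  (Bundle.TotalSpace.proj ⁻¹' tsupport f) ∩
    tangentCoord n c ⁻¹' (Set.univ ×ˢ Metric.closedBall 0 2)

/-- The coordinates are continuous only on the chart domain, but the closed support of `f` lies
inside it. -/
lemma isClosed_bumpCarrier {c : M} (f : SmoothBumpFunction (𝓡 n) c) :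
    IsClosed (bumpCarrier f) := by
  have hcont : Continuous (Bundle.TotalSpace.proj : TangentBundle (𝓡 n) M → M) :=
    FiberBundle.continuous_proj _ _
  refine ContinuousOn.preimage_isClosed_of_isClosed ?_ ((isClosed_tsupport f).preimage hcont)
    (isClosed_univ.prod Metric.isClosed_closedBall)
  exact (contMDiffOn_tangentCoord c).continuousOn.mono fun p hp =>
    mem_tangentChart_source.2 (f.tsupport_subset_chartAt_source hp)

lemma isCompact_bumpCarrier {c : M} (f : SmoothBumpFunction (𝓡 n) c) :
    IsCompact (bumpCarrier f) := by
  let A : Set (EuclideanSpace ℝ (Fin n) × EuclideanSpace ℝ (Fin n)) :=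
    (extChartAt (𝓡 n) c '' tsupport f) ×ˢ Metric.closedBall 0 2
  have hA : IsCompact A := by
    refine (f.hasCompactSupport.isCompact.image_of_continuousOn ?_).prod (isCompact_closedBall _ _)
    exact (continuousOn_extChartAt c).mono f.tsupport_subset_extChartAt_source
  have hAt : A ⊆ (tangentCoord n c).target := by
    rintro z ⟨⟨x, hx, hxz⟩, -⟩
    rw [mem_tangentCoord_target, ← hxz]
    exact (extChartAt (𝓡 n) c).map_source (f.tsupport_subset_extChartAt_source hx)
  have hcont : ContinuousOn (tangentCoord n c).symm (tangentCoord n c).target :=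
    (tangentChart n c).continuousOn_extend_symm
  refine (hA.image_of_continuousOn (hcont.mono hAt)).of_isClosed_subset (isClosed_bumpCarrier f) ?_
  rintro p ⟨hp, hp2⟩
  refine ⟨tangentCoord n c p, ⟨⟨p.proj, hp, rfl⟩, hp2.2⟩, (tangentCoord n c).left_inv ?_⟩
  rw [tangentCoord_source]
  exact mem_tangentChart_source.2 (f.tsupport_subset_chartAt_source hp)

lemma bumpDeformation_eq_zero {c : M} (f : SmoothBumpFunction (𝓡 n) c)
    (w : ℝ × EuclideanSpace ℝ (Fin n)) {p : TangentBundle (𝓡 n) M} (hp : p ∉ bumpCarrier f) :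
    bumpDeformation f w p = 0 := by
  rw [bumpDeformation_apply]
  by_cases h : p.proj ∈ tsupport f
  · have h2 : (tangentCoord n c p).2 ∉ Metric.closedBall 0 2 := fun h2 => hp ⟨h, trivial, h2⟩
    rw [(velocityBump n).zero_of_le_dist, zero_smul, smul_zero]
    rw [Metric.mem_closedBall, not_le] at h2
    exact h2.le
  · rw [image_eq_zero_of_notMem_tsupport h, zero_smul]

lemma bumpDeformation_zeroVec {c x : M} (f : SmoothBumpFunction (𝓡 n) c) (hx : f x = 1)
    (w : ℝ × EuclideanSpace ℝ (Fin n)) : bumpDeformation f w (zeroVec n x) = w.2 := by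
  have hxc : x ∈ (chartAt (EuclideanSpace ℝ (Fin n)) c).source :=
    f.support_subset_source (by simp [hx])
  rw [bumpDeformation_apply, tangentCoord_zeroVec hxc]
  have : velocityBump n 0 = 1 := (velocityBump n).eventuallyEq_one.self_of_nhds
  simp [this, zeroVec, hx]

lemma fiberDeriv_bumpDeformation {c x : M} (f : SmoothBumpFunction (𝓡 n) c) (hx : f x = 1)
    (w : ℝ × EuclideanSpace ℝ (Fin n)) :
    fiberDeriv c (bumpDeformation f w) x = w.1 • ContinuousLinearMap.id ℝ _ := by
  have hxc : x ∈ (chartAt (EuclideanSpace ℝ (Fin n)) c).source :=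
    f.support_subset_source (by simp [hx])
  have hxe : x ∈ (extChartAt (𝓡 n) c).source := by rwa [extChartAt_source]
  have h1 : HasFDerivAt (fun v => coordRep c (bumpDeformation f w) (extChartAt (𝓡 n) c x, v))
      (fiberDeriv c (bumpDeformation f w) x) 0 :=
    HasFDerivAt.comp (g := coordRep c (bumpDeformation f w)) 0
      ((contDiffAt_coordRep _ (zero_mem_tangentCoord_target hxc)).differentiableAt
        (by simp)).hasFDerivAt (hasFDerivAt_prodMk_right _ _)
  have h2 : HasFDerivAt (fun v : EuclideanSpace ℝ (Fin n) => w.2 + w.1 • v)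
      (w.1 • ContinuousLinearMap.id ℝ _) 0 := ((hasFDerivAt_id _).const_smul w.1).const_add w.2
  refine h1.unique (h2.congr_of_eventuallyEq ?_)
  -- The cut-off is identically `1` near zero velocity, so it does not contribute to the derivative.
  filter_upwards [(velocityBump n).eventuallyEq_one] with v hv
  have hz : (extChartAt (𝓡 n) c x, v) ∈ (tangentCoord n c).target :=
    mem_tangentCoord_target.2 ((extChartAt (𝓡 n) c).map_source hxe)
  rw [coordRep, Function.comp_apply, bumpDeformation_apply, (tangentCoord n c).right_inv hz,
    tangentCoord_symm_proj, (extChartAt (𝓡 n) c).left_inv hxe, hx, hv]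
  simp

/-- The deformations associated with a smooth bump covering. -/
def bumpDeformationFamily {ι : Type*} {c : ι → M} (f : ∀ i, SmoothBumpFunction (𝓡 n) (c i))
    (hf : LocallyFinite fun i => Function.support (f i)) :
    DeformationFamily (TangentBundle (𝓡 n) M) (EuclideanSpace ℝ (Fin n)) (𝓡 n).tangent ι
      (ℝ × EuclideanSpace ℝ (Fin n)) where
  toFun i := bumpDeformation (f i)
  carrier i := bumpCarrier (f i)
  isClosed_carrier i := isClosed_bumpCarrier (f i)
  isCompact_carrier i := isCompact_bumpCarrier (f i)
  locallyFinite := (hf.closure.preimage_continuous (FiberBundle.continuous_proj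
    (EuclideanSpace ℝ (Fin n)) (TangentSpace (𝓡 n) : M → Type _))).subset
      fun _ => Set.inter_subset_left
  eq_zero i w _ hp := bumpDeformation_eq_zero (f i) w hp

/-- The deformed system still has locally bounded derivatives. -/
lemma isProperMap_folding_add {ι : Type*} {c : ι → M} (f : ∀ i, SmoothBumpFunction (𝓡 n) (c i))
    (hf : LocallyFinite fun i => Function.support (f i)) {F : System n M}
    (hF : IsProperMap (folding F)) (s : ι → ℝ × EuclideanSpace ℝ (Fin n)) :
    IsProperMap (folding (F + (bumpDeformationFamily f hf).sum s)) := by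
  have : LocallyCompactSpace M := ChartedSpace.locallyCompactSpace (EuclideanSpace ℝ (Fin n)) M
  have hproj : Continuous (Bundle.TotalSpace.proj : TangentBundle (𝓡 n) M → M) :=
    FiberBundle.continuous_proj _ _
  set G := F + (bumpDeformationFamily f hf).sum s with hG
  rw [isProperMap_iff_isCompact_preimage] at hF ⊢
  refine ⟨hproj.comp continuous_subtype_val, fun K hK => ?_⟩
  have hfin := hf.closure.finite_nonempty_inter_compact hK
  -- Over `K` the new surface lies in the old one together with the finitely many carriers that can
  -- meet the fibres over `K`.
  have hcomp : IsCompact (Subtype.val '' (folding F ⁻¹' K) ∪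
      ⋃ i ∈ hfin.toFinset, bumpCarrier (f i)) :=
    ((hF.2 hK).image continuous_subtype_val).union
      (hfin.toFinset.isCompact_biUnion fun i _ => isCompact_bumpCarrier (f i))
  rw [Subtype.isCompact_iff]
  have himg : Subtype.val '' (folding G ⁻¹' K) = surface G ∩ Bundle.TotalSpace.proj ⁻¹' K := by
    ext p
    constructor
    · rintro ⟨q, hq, rfl⟩
      exact ⟨q.2, hq⟩
    · rintro ⟨hp, hpK⟩
      exact ⟨⟨p, hp⟩, hpK, rfl⟩
  rw [himg]
  refine hcomp.of_isClosed_subset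
    ((isClosed_eq G.contMDiff.continuous continuous_const).inter (hK.isClosed.preimage hproj)) ?_
  rintro p ⟨hp, hpK⟩
  by_cases h : ∃ i, p ∈ bumpCarrier (f i)
  · obtain ⟨i, hi⟩ := h
    refine Or.inr (Set.mem_biUnion (x := i) ?_ hi)
    simp only [Set.Finite.coe_toFinset]
    exact ⟨p.proj, hi.1, hpK⟩
  · push Not at h
    have hp0 : (bumpDeformationFamily f hf).sum s p = 0 := by
      rw [DeformationFamily.sum_apply]
      exact finsum_eq_zero_of_forall_eq_zero fun i => bumpDeformation_eq_zero (f i) _ (h i)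
    refine Or.inl ⟨⟨p, ?_⟩, hpK, rfl⟩
    have : F p + (bumpDeformationFamily f hf).sum s p = 0 := hp
    rwa [hp0, add_zero] at this

end Deformation

/-! ### Openness and density of regularity along the zero section. -/

section Genericity

variable {n : ℕ} {M : Type*} [TopologicalSpace M] [ChartedSpace (EuclideanSpace ℝ (Fin n)) M]

lemma setOf_bump_eq_one_subset {c : M} (f : SmoothBumpFunction (𝓡 n) c) :
    {x | f x = 1} ⊆ (chartAt (EuclideanSpace ℝ (Fin n)) c).source := fun x hx =>
  f.support_subset_source (by simp [show f x = 1 from hx])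

variable [T2Space M] [IsManifold (𝓡 n) ∞ M]

lemma exists_countable_bump_covering (n : ℕ) (M : Type*) [TopologicalSpace M] [T2Space M]
    [SecondCountableTopology M] [ChartedSpace (EuclideanSpace ℝ (Fin n)) M]
    [IsManifold (𝓡 n) ∞ M] :
    ∃ (ι : Type) (_ : Countable ι) (c : ι → M) (f : ∀ i, SmoothBumpFunction (𝓡 n) (c i)),
      LocallyFinite (fun i => Function.support (f i)) ∧ ∀ x, ∃ i, f i x = 1 := by
  have : LocallyCompactSpace M := ChartedSpace.locallyCompactSpace (EuclideanSpace ℝ (Fin n)) M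
  obtain ⟨ι, f, -⟩ := SmoothBumpCovering.exists_isSubordinate (𝓡 n) (M := M) (s := Set.univ)
    (U := fun _ => Set.univ) isClosed_univ fun _ _ => Filter.univ_mem
  have hc : Countable ι := Set.countable_univ_iff.1 <|
    f.locallyFinite.countable_univ fun i => (f i).nonempty_support
  -- The Whitney topology is indexed by families in `Type`, so the countable index type is moved
  -- there.
  let e := (equivShrink.{0} ι).symm
  refine ⟨Shrink.{0} ι, e.injective.countable, fun i => f.c (e i), fun i => f (e i),
    f.locallyFinite.comp_injective e.injective, fun x => ?_⟩
  obtain ⟨i, hi⟩ := f.eventuallyEq_one' x (Set.mem_univ x)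
  obtain ⟨j, rfl⟩ := e.surjective i
  exact ⟨j, hi.self_of_nhds⟩

lemma isCompact_setOf_bump_eq_one {c : M} (f : SmoothBumpFunction (𝓡 n) c) :
    IsCompact {x | f x = 1} :=
  f.hasCompactSupport.isCompact.of_isClosed_subset
    (isClosed_eq f.continuous continuous_const) fun x hx =>
      subset_tsupport _ (by simp [show f x = 1 from hx])

variable {ι : Type} {c : ι → M} (f : ∀ i, SmoothBumpFunction (𝓡 n) (c i))

lemma isOpen_setOf_isRegularZero (hf : LocallyFinite fun i => Function.support (f i)) :
    IsOpen[whitneyTopology (𝓡 n).tangent]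
      {F : System n M | ∀ i, ∀ x ∈ {x | f i x = 1}, IsRegularZero (c i) F x} := by
  have hproj : Continuous (Bundle.TotalSpace.proj : TangentBundle (𝓡 n) M → M) :=
    FiberBundle.continuous_proj _ _
  let : TopologicalSpace (System n M) := whitneyTopology (𝓡 n).tangent
  rw [isOpen_iff_forall_mem_open]
  intro F hF
  choose ε hε hεG using fun i => exists_forall_isRegularZero
    (isCompact_setOf_bump_eq_one (f i)) (setOf_bump_eq_one_subset (f i)) (hF i)
  have hopen := fun i => (f i).isOpen_support.preimage hproj
  -- Restricting to the bump supports makes the chart domains locally finite and leaves the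
  -- derivatives read in the charts unchanged.
  let φ := fun i => (tangentChart n (c i)).restr (Bundle.TotalSpace.proj ⁻¹' Function.support (f i))
  have hφs : ∀ i, (φ i).source = (tangentChart n (c i)).source ∩
      (Bundle.TotalSpace.proj ⁻¹' Function.support (f i)) := fun i =>
    OpenPartialHomeomorph.restr_source' _ _ (hopen i)
  let K := fun i => zeroVec n '' {x | f i x = 1}
  refine ⟨strongNhd _ F 1 φ K ε, fun G hG i => hεG i G (hG i), ?_, ?_⟩
  · refine TopologicalSpace.isOpen_generateFrom_of_mem ⟨F, 1, ι, φ, K, ε, fun i => ?_, ?_,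
      fun i => ⟨(isCompact_setOf_bump_eq_one (f i)).image continuous_zeroVec, ?_⟩, hε, rfl⟩
    · exact restr_mem_maximalAtlas _ (tangentChart_mem_maximalAtlas (c i)) (hopen i)
    · exact (hf.preimage_continuous hproj).subset fun i p hp => ((hφs i).subset hp).2
    · rintro _ ⟨x, hx, rfl⟩
      rw [hφs]
      refine ⟨mem_tangentChart_source.2 (setOf_bump_eq_one_subset (f i) hx), ?_⟩
      simp [zeroVec, show f i x = 1 from hx]
  · intro i x _ k _
    simpa using hε i

lemma dense_setOf_isRegularZero (hf : LocallyFinite fun i => Function.support (f i))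
    (F : System n M) {η : ι → ℝ} (hη : ∀ i, 0 < η i) (k : ι) :
    Dense {s : ∀ i, Metric.closedBall (0 : ℝ × EuclideanSpace ℝ (Fin n)) (η i) |
      ∀ x ∈ {x | f k x = 1}, IsRegularZero (c k)
        (F + (bumpDeformationFamily f hf).sum fun i =>
          (s i : ℝ × EuclideanSpace ℝ (Fin n))) x} := by
  classical
  intro s
  rw [mem_closure_iff]
  intro U hU hsU
  let s₀ : ι → ℝ × EuclideanSpace ℝ (Fin n) := fun i => s i
  have hΨ : Continuous fun w : Metric.closedBall (0 : ℝ × EuclideanSpace ℝ (Fin n)) (η k) =>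
    Function.update s k w := continuous_const.update k continuous_id
  obtain ⟨O, hO, hOU⟩ := isOpen_induced_iff.1 (hU.preimage hΨ)
  have hsO : s₀ k ∈ O := by
    have : s k ∈ (Subtype.val ⁻¹' O : Set (Metric.closedBall
        (0 : ℝ × EuclideanSpace ℝ (Fin n)) (η k))) := by
      rw [hOU, Set.mem_preimage, Function.update_eq_self]
      exact hsU
    exact this
  -- The parameter may lie on the boundary sphere; the closed ball is the closure of the open one,
  -- so an open set of admissible shifts remains.
  have hne : (O ∩ Metric.ball 0 (η k)).Nonempty := by
    have : s₀ k ∈ closure (Metric.ball (0 : ℝ × EuclideanSpace ℝ (Fin n)) (η k)) := by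
      rw [closure_ball _ (hη k).ne']
      exact (s k).2
    exact mem_closure_iff.1 this O hO hsO
  -- The `k`-th deformation is removed, so the shift found below is the new parameter itself, not an
  -- increment.
  let F₀ : System n M := F + (bumpDeformationFamily f hf).sum (Function.update s₀ k 0)
  have hsrc : {x | f k x = 1} ⊆ (extChartAt (𝓡 n) (c k)).source := by
    rw [extChartAt_source]
    exact setOf_bump_eq_one_subset (f k)
  have htgt : extChartAt (𝓡 n) (c k) '' {x | f k x = 1} ⊆ (extChartAt (𝓡 n) (c k)).target := by
    rintro _ ⟨x, hx, rfl⟩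
    exact (extChartAt (𝓡 n) (c k)).map_source (hsrc hx)
  obtain ⟨w, ⟨hwO, hwη⟩, hw⟩ := exists_shift_det_ne_zero
    (f := fun y => coordRep (c k) F₀ (y, 0))
    (B := fun y => (fderiv ℝ (coordRep (c k) F₀) (y, 0)).comp (ContinuousLinearMap.inr ℝ _ _))
    ((isCompact_setOf_bump_eq_one (f k)).image_of_continuousOn
      ((continuousOn_extChartAt (c k)).mono hsrc))
    (by
      intro y hy
      have h := (contDiffAt_coordRep F₀ (mem_tangentCoord_target (c := c k) (z := (y, 0)).2
        (htgt hy))).differentiableAt (by simp)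
      exact (DifferentiableAt.comp (g := coordRep (c k) F₀) y h (differentiableAt_id.prodMk
        (differentiableAt_const _))).differentiableWithinAt)
    ((continuousOn_fderiv_coordRep (c k) F₀).mono htgt)
    (hO.inter Metric.isOpen_ball) hne
  let w' : Metric.closedBall (0 : ℝ × EuclideanSpace ℝ (Fin n)) (η k) :=
    ⟨w, Metric.ball_subset_closedBall hwη⟩
  refine ⟨Function.update s k w', ?_, ?_⟩
  · have : w' ∈ (Subtype.val ⁻¹' O : Set (Metric.closedBall
        (0 : ℝ × EuclideanSpace ℝ (Fin n)) (η k))) := hwO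
    rwa [hOU] at this
  · intro x hx
    have hcoe : (fun i => (Function.update s k w' i : ℝ × EuclideanSpace ℝ (Fin n))) =
        Function.update s₀ k w := by
      ext1 i
      rcases eq_or_ne i k with rfl | hi
      · simp [w']
      · simp [hi, s₀]
    have hsum : F + (bumpDeformationFamily f hf).sum (Function.update s₀ k w) =
        F₀ + bumpDeformation (f k) w := by
      rw [DeformationFamily.sum_update, ← add_assoc]
      rfl
    rw [hcoe, hsum]
    intro hzero
    rw [fiberDeriv_add (setOf_bump_eq_one_subset (f k) hx), fiberDeriv_bumpDeformation (f k) hx]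
    refine hw _ ⟨x, hx, rfl⟩ ?_
    rw [coordRep_zero (setOf_bump_eq_one_subset (f k) hx), ← bumpDeformation_zeroVec (f k) hx w]
    exact hzero

/-- The product topology suffices because only finitely many parameters act over a compact set. -/
lemma isOpen_setOf_parameter_isRegularZero (hf : LocallyFinite fun i => Function.support (f i))
    (F : System n M) (k : ι) :
    IsOpen {s : ι → ℝ × EuclideanSpace ℝ (Fin n) | ∀ x ∈ {x | f k x = 1},
      IsRegularZero (c k) (F + (bumpDeformationFamily f hf).sum s) x} := by
  rw [isOpen_iff_mem_nhds]
  intro s hs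
  obtain ⟨ε, hε, h⟩ := exists_forall_isRegularZero (isCompact_setOf_bump_eq_one (f k))
    (setOf_bump_eq_one_subset (f k)) hs
  have hK : zeroVec n '' {x | f k x = 1} ⊆ (tangentChart n (c k)).source := by
    rintro _ ⟨x, hx, rfl⟩
    exact mem_tangentChart_source.2 (setOf_bump_eq_one_subset (f k) hx)
  filter_upwards [(bumpDeformationFamily f hf).eventually_norm_chartDeriv_sub_lt
    (tangentChart_mem_maximalAtlas (c k))
    ((isCompact_setOf_bump_eq_one (f k)).image continuous_zeroVec) hK F s 1 hε] with s' hs'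
  exact h _ hs'

/-- Arbitrarily small parameters make the deformed system regular over the whole manifold. -/
lemma exists_sum_isRegularZero [Countable ι] (hf : LocallyFinite fun i => Function.support (f i))
    (F : System n M) {η : ι → ℝ} (hη : ∀ i, 0 < η i) :
    ∃ s : ι → ℝ × EuclideanSpace ℝ (Fin n), (∀ i, ‖s i‖ ≤ η i) ∧ ∀ k, ∀ x ∈ {x | f k x = 1},
      IsRegularZero (c k) (F + (bumpDeformationFamily f hf).sum s) x := by
  have hcoe : Continuous fun s : ∀ i, Metric.closedBall (0 : ℝ × EuclideanSpace ℝ (Fin n)) (η i) =>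
    fun i => (s i : ℝ × EuclideanSpace ℝ (Fin n)) := by fun_prop
  have : ∀ i, CompactSpace (Metric.closedBall (0 : ℝ × EuclideanSpace ℝ (Fin n)) (η i)) :=
    fun i => isCompact_iff_compactSpace.1 (isCompact_closedBall _ _)
  have : ∀ i, Nonempty (Metric.closedBall (0 : ℝ × EuclideanSpace ℝ (Fin n)) (η i)) :=
    fun i => ⟨⟨0, Metric.mem_closedBall_self (hη i).le⟩⟩
  -- The product of closed balls is compact Hausdorff, hence a Baire space, and `ι` is countable.
  have hdense := dense_iInter_of_isOpen
    (fun k => (isOpen_setOf_parameter_isRegularZero f hf F k).preimage hcoe)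
    (fun k => dense_setOf_isRegularZero f hf F hη k)
  obtain ⟨s, hs⟩ := hdense.nonempty
  rw [Set.mem_iInter] at hs
  exact ⟨fun i => s i, fun i => mem_closedBall_zero_iff.1 (s i).2, hs⟩

end Genericity

end ImplicitSystem

end

theorem proposition3 (n : ℕ) (M : Type*) [TopologicalSpace M] [T2Space M]
    [SecondCountableTopology M] [ChartedSpace (EuclideanSpace ℝ (Fin n)) M]
    [IsManifold (𝓡 n) ∞ M] :
    ImplicitSystem.Generic (fun F : ImplicitSystem.System n M =>
      ∀ p : ImplicitSystem.surface F, ImplicitSystem.IsCriticalPoint F p →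
        p.1 ∉ Set.range (Bundle.zeroSection (EuclideanSpace ℝ (Fin n))
          (TangentSpace (𝓡 n) : M → Type _)) ∧
        ∀ᶠ q in 𝓝 p, (ImplicitSystem.oneFolding F q).Dom) := by
  obtain ⟨ι, _, c, f, hf, hcov⟩ := ImplicitSystem.exists_countable_bump_covering n M
  refine ⟨Subtype.val ⁻¹' {F : ImplicitSystem.System n M | ∀ i, ∀ x ∈ {x | f i x = 1},
    ImplicitSystem.IsRegularZero (c i) F x},
    ⟨_, ImplicitSystem.isOpen_setOf_isRegularZero f hf, rfl⟩, ?_, ?_⟩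
  · intro F
    rw [mem_closure_iff]
    rintro _ ⟨N, hN, rfl⟩ hF
    obtain ⟨η, hη, hηN⟩ := (ImplicitSystem.bumpDeformationFamily f hf).exists_forall_add_sum_mem
      F.1 hN hF
    obtain ⟨s, hs, hreg⟩ := ImplicitSystem.exists_sum_isRegularZero f hf F.1 hη
    exact ⟨⟨_, ImplicitSystem.isProperMap_folding_add f hf F.2 s⟩, hηN s hs, hreg⟩
  · intro F hF p hp
    have hzero : p.1 ∉ Set.range (Bundle.zeroSection (EuclideanSpace ℝ (Fin n))
        (TangentSpace (𝓡 n) : M → Type _)) := by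
      rintro ⟨x, hx⟩
      have hpx : p.1.proj = x := by rw [← hx]; rfl
      obtain ⟨i, hi⟩ := hcov p.1.proj
      refine (hF i _ hi).not_isCriticalPoint
        (ImplicitSystem.setOf_bump_eq_one_subset (f i) hi) ?_ hp
      rw [hpx]
      exact hx.symm
    exact ⟨hzero, ImplicitSystem.eventually_oneFolding_dom hzero⟩
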